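/- Let $M$ be a compact smooth Riemannian manifold without boundary, with tangent norm $|\cdot|$. Let $K:M\times M\to\mathbb R$ be continuous with $K(x,y)\ge C$ for all $x,y\in M$ and some constant $C>0$, and let $W:M\times M\to\mathbb R$ be symmetric, $W(x,y)=W(y,x)$, and of class $C^{1,\alpha}$ for some $\alpha>0$. For a Borel probability measure $\mu$ on $M$ put $$m_\mu(x)=\int_M K(x,y)\,d\mu(y),\qquad W[\mu](x)=\int_M W(x,y)\,d\mu(y),\qquad \mathsf V[\mu](x)=\frac{1}{m_\mu(x)}\,\nabla W[\mu](x),$$ where $\nabla$ is the Riemannian gradient. A family $(\mu_t)_{t>0}$ of Borel probability measures on $M$ is called a weak solution of the self-attention continuity equation $$\partial_t\mu_t+\operatorname{div}\big(\mathsf V[\mu_t]\,\mu_t\big)=0$$ if for every $T>0$ the curve $t\mapsto\mu_t$ is narrowly continuous on $(0,T)$, $\int_0^T\int_M|\mathsf V[\mu_t]|\,d\mu_t\,dt<\infty$, and $$\int_0^T\int_M \partial_t\varphi(x,t)+\big\langle \mathcal D_x\varphi(x,t),\mathsf V[\mu_t](x)\big\rangle\,d\mu_t(x)\,dt=0\qquad\text{for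 all }\varphi\in C^1_c(M\times(0,T)).$$ A probability measure $\nu$ is called a stationary solution if the constant curve $\mu_t=\nu$ is a weak solution. Then for every weak solution $(\mu_t)_{t>0}$ there exist a sequence $t_k\to\infty$ and a probability measure $\nu$ on $M$ such that $\mu_{t_k}$ converges narrowly to $\nu$ as $k\to\infty$, and $\nu$ is a stationary solution. (For $M$ the unit sphere in $\mathbb R^d$, $D$ a symmetric matrix, $K(x,y)=e^{x\cdot Dy}$ and $W(x,y)=\pm e^{x\cdot Dy}$, the field $\mathsf V[\mu]$ is the self-attention velocity field $P_x^\perp\big(\int e^{x\cdot Dy}\,Vy\,d\mu(y)\big)/\int e^{x\cdot Dy}\,d\mu(y)$ with $V=\pm D$, where $P_x^\perp z=z-(x\cdot z)x$.) -/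

import Mathlib

open Set Filter Topology MeasureTheory Bundle
open scoped Manifold ContDiff NNReal ENNReal

noncomputable section

namespace SelfAttention

section Kernel

variable {M : Type*} [MeasurableSpace M]

/-- `F[μ](x) = ∫ F(x, y) dμ(y)`. For the kernel `F = K` this is the mobility `m_μ`, for `F = W` it
is the potential `W[μ]`, i.e. the first variation of
`μ ↦ (1/2) ∫∫ W(x, y) dμ(x) dμ(y)` when `W` is symmetric. -/
def kernelAverage (F : M → M → ℝ) (μ : Measure M) (x : M) : ℝ :=
  ∫ y, F x y ∂μ

end Kernel

section Manifold

variable {n : ℕ} {M : Type*} [TopologicalSpace M] [ChartedSpace (EuclideanSpace ℝ (Fin n)) M]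

/-- A real function on `M × M` is of class `C^{1,α}`: it is `C^1`, and around every point its
derivative, read in the product chart at this point, is Hölder continuous with exponent `α`.
(On a compact manifold this local condition is the same as the global one.) -/
def IsC1Holder (α : ℝ≥0) (W : M → M → ℝ) : Prop :=
  ContMDiff ((𝓡 n).prod (𝓡 n)) 𝓘(ℝ, ℝ) 1 (Function.uncurry W) ∧
  ∀ p : M × M, ∃ C : ℝ≥0,
    ∃ s ∈ 𝓝 (extChartAt ((𝓡 n).prod (𝓡 n)) p p),
      HolderOnWith C α
        (fderiv ℝ (Function.uncurry W ∘ (extChartAt ((𝓡 n).prod (𝓡 n)) p).symm)) s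

/-- Test functions `φ ∈ C_c^1(M × (0,T))`, extended by zero to `M × ℝ`. -/
def IsTestFunction (T : ℝ) (φ : M × ℝ → ℝ) : Prop :=
  ContMDiff ((𝓡 n).prod 𝓘(ℝ, ℝ)) 𝓘(ℝ, ℝ) 1 φ ∧
  HasCompactSupport φ ∧
  tsupport φ ⊆ univ ×ˢ Ioo 0 T

variable [RiemannianBundle (fun x : M ↦ TangentSpace (𝓡 n) x)]

/-- The inverse duality map `T_x^*M → T_xM`, `ℓ ↦ |ℓ|_* argmax_{|v| = 1} ℓ(v)`. As the norm of
`T_xM` comes from an inner product, it is the inverse of the Riesz isomorphism. -/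
def dualityMap (x : M) (ℓ : TangentSpace (𝓡 n) x →L[ℝ] ℝ) : TangentSpace (𝓡 n) x :=
  have : FiniteDimensional ℝ (TangentSpace (𝓡 n) x) :=
    inferInstanceAs (FiniteDimensional ℝ (EuclideanSpace ℝ (Fin n)))
  have : CompleteSpace (TangentSpace (𝓡 n) x) := FiniteDimensional.complete ℝ _
  (InnerProductSpace.toDual ℝ (TangentSpace (𝓡 n) x)).symm ℓ

theorem inner_dualityMap (x : M) (ℓ : TangentSpace (𝓡 n) x →L[ℝ] ℝ)
    (v : TangentSpace (𝓡 n) x) : inner ℝ (dualityMap x ℓ) v = ℓ v := by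
  have : FiniteDimensional ℝ (TangentSpace (𝓡 n) x) :=
    inferInstanceAs (FiniteDimensional ℝ (EuclideanSpace ℝ (Fin n)))
  have : CompleteSpace (TangentSpace (𝓡 n) x) := FiniteDimensional.complete ℝ _
  exact InnerProductSpace.toDual_symm_apply

variable [MeasurableSpace M]

/-- The velocity field `V[μ] = (1 / m_μ) J(D W[μ])`, with `m_μ(x) = ∫ K(x, y) dμ(y)`. -/
def velocity (K W : M → M → ℝ) (μ : Measure M) (x : M) : TangentSpace (𝓡 n) x :=
  (kernelAverage K μ x)⁻¹ • dualityMap x (mvfderiv (𝓡 n) (kernelAverage W μ) x)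

variable [BorelSpace M]

/-- `(μ_t)` is a weak solution on `(0,T)` of `∂_t μ + div (V[μ] μ) = 0`: the curve is narrowly
continuous, `∫_0^T ∫ |V[μ_t]| dμ_t dt < ∞`, and the equation holds in the sense of distributions. -/
def IsWeakSolutionOn (K W : M → M → ℝ) (T : ℝ) (μ : ℝ → ProbabilityMeasure M) : Prop :=
  ContinuousOn μ (Ioo 0 T) ∧
  ∫⁻ t in Ioo 0 T, ∫⁻ x, ‖velocity (n := n) K W (μ t : Measure M) x‖ₑ ∂(μ t : Measure M) < ⊤ ∧
  ∀ φ : M × ℝ → ℝ, IsTestFunction (n := n) T φ →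
    ∫ t in Ioo 0 T, ∫ x,
      (deriv (fun s ↦ φ (x, s)) t +
        mvfderiv (𝓡 n) (fun y ↦ φ (y, t)) x (velocity (n := n) K W (μ t : Measure M) x))
        ∂(μ t : Measure M) = 0

/-- A weak solution for all positive times. -/
def IsWeakSolution (K W : M → M → ℝ) (μ : ℝ → ProbabilityMeasure M) : Prop :=
  ∀ T : ℝ, 0 < T → IsWeakSolutionOn (n := n) K W T μ

/-- `ν` is a stationary solution: the constant curve `μ_t = ν` is a weak solution. -/
def IsStationarySolution (K W : M → M → ℝ) (ν : ProbabilityMeasure M) : Prop :=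
  IsWeakSolution (n := n) K W (fun _ ↦ ν)

end Manifold

end SelfAttention

end

/-! The interaction energy `E(μ) = ∫∫ W dμ dμ` is a Lyapunov functional. Since `∇W[μ] = m_μ V[μ]`,
formally `d/dt E(μ_t) = 2 ∫ ⟨∇W[μ_t], V[μ_t]⟩ dμ_t = 2 ∫ m_{μ_t} |V[μ_t]|² dμ_t ≥ 0`. As `E` is
narrowly continuous on the compact space of probability measures, it is bounded, so its increments
over unit time intervals tend to zero and the mean value theorem yields times `t_k → ∞` along which
the dissipation vanishes. A narrow limit point `ν` has zero dissipation by continuity; as `m_ν > 0`,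
`V[ν] = 0` holds `ν`-a.e., which makes `ν` stationary.

Two points need care. The test function `W[μ_t]` moves with `t`, so one copy of the measure is
frozen: `IsWeakSolution.hasDerivAt_integral_kernelAverage` differentiates `t ↦ ∫ W[ν] dμ_t`
classically, and `hasDerivAt_diag_of_symm` recovers the derivative of `E` from the symmetry of `W`.
The rate must be narrowly continuous: `mvfderiv_kernelAverage_velocity` expresses it through
integrals of the continuous kernel `⟨∇_x W(x, y), ∇_x W(x, z)⟩`. -/

/-! ### Integrals depending on a parameter -/

/-- The integral of a jointly continuous function against a narrowly continuous family of
probability measures on a compact space depends continuously on the parameter. -/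
theorem continuous_integral_probabilityMeasure {X M : Type*} [TopologicalSpace X]
    [TopologicalSpace M] [CompactSpace M] [MeasurableSpace M] [BorelSpace M] {F : X → M → ℝ}
    (hF : Continuous (Function.uncurry F)) {κ : X → ProbabilityMeasure M} (hκ : Continuous κ) :
    Continuous fun x ↦ ∫ y, F x y ∂(κ x : Measure M) := by
  -- Currying turns joint continuity into sup-norm continuity of `x ↦ F x ·`. The error then splits
  -- into a fixed integrand against a moving measure and a uniformly small integrand against mass
  -- one.
  let G : C(X, C(M, ℝ)) := ContinuousMap.curry ⟨Function.uncurry F, hF⟩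
  have hint (g : C(M, ℝ)) (ν : ProbabilityMeasure M) : Integrable g (ν : Measure M) :=
    g.continuous.integrable_of_hasCompactSupport (HasCompactSupport.of_compactSpace _)
  rw [continuous_iff_continuousAt]
  intro x₀
  have h1 : Tendsto (fun x ↦ ∫ y, G x₀ y ∂(κ x : Measure M)) (𝓝 x₀)
      (𝓝 (∫ y, G x₀ y ∂(κ x₀ : Measure M))) :=
    ((ProbabilityMeasure.continuous_integral_continuousMap (G x₀)).comp hκ).continuousAt
  have h2 : Tendsto (fun x ↦ ∫ y, (G x - G x₀) y ∂(κ x : Measure M)) (𝓝 x₀) (𝓝 0) := by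
    refine squeeze_zero_norm (a := fun x ↦ ‖G x - G x₀‖) (fun x ↦ ?_) ?_
    · simpa using norm_integral_le_of_norm_le_const (μ := (κ x : Measure M))
        (Eventually.of_forall fun y ↦ (G x - G x₀).norm_coe_le_norm y)
    · have : Continuous fun x ↦ ‖G x - G x₀‖ := by fun_prop
      simpa using this.tendsto x₀
  have h3 := h1.add h2
  rw [add_zero] at h3
  refine h3.congr fun x ↦ ?_
  rw [← integral_add (hint _ _) (hint _ _)]
  refine integral_congr_ae (Eventually.of_forall fun y ↦ ?_)
  simp [G]

/-- Differentiation under the integral sign over a compact space. -/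
theorem hasFDerivAt_integral_of_continuousAt_uncurry {E M : Type*} [NormedAddCommGroup E]
    [NormedSpace ℝ E] [FiniteDimensional ℝ E] [TopologicalSpace M] [CompactSpace M]
    [MeasurableSpace M] [BorelSpace M] {ν : Measure M} [IsFiniteMeasure ν] {U : Set E}
    (hU : IsOpen U) {f : E → M → ℝ} {f' : E → M → E →L[ℝ] ℝ}
    (hf : ∀ u ∈ U, Continuous (f u))
    (hd : ∀ u ∈ U, ∀ y, HasFDerivAt (f · y) (f' u y) u)
    (hf' : ∀ u ∈ U, ∀ y, ContinuousAt (Function.uncurry f') (u, y)) {u₀ : E} (hu₀ : u₀ ∈ U) :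
    HasFDerivAt (fun u ↦ ∫ y, f u y ∂ν) (∫ y, f' u₀ y ∂ν) u₀ ∧
      ContinuousAt (fun u ↦ ∫ y, f' u y ∂ν) u₀ := by
  have hcont (u) (hu : u ∈ U) : Continuous (f' u) :=
    continuous_iff_continuousAt.2 fun y ↦
      (hf' u hu y).comp (f := fun y ↦ (u, y)) (by fun_prop)
  have hUn : U ∈ 𝓝 u₀ := hU.mem_nhds hu₀
  obtain ⟨C, hC⟩ : ∃ C : ℝ, ∀ y, ‖f' u₀ y‖ ≤ C := by
    obtain ⟨C, hC⟩ := isCompact_univ.exists_bound_of_continuousOn (hcont u₀ hu₀).continuousOn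
    exact ⟨C, fun y ↦ hC y (mem_univ y)⟩
  -- Compactness of `M` gives one neighbourhood of `u₀` that works for all `y`, hence a constant
  -- dominating function.
  have hbound : ∀ᶠ u in 𝓝 u₀, ∀ y ∈ (univ : Set M), ‖f' u y‖ ≤ C + 1 := by
    refine isCompact_univ.eventually_forall_of_forall_eventually
      (P := fun u y ↦ ‖f' u y‖ ≤ C + 1) fun y _ ↦ ?_
    have h := (hf' u₀ hu₀ y).norm.eventually_lt_const
      (show ‖Function.uncurry f' (u₀, y)‖ < C + 1 by
        have := hC y
        simp only [Function.uncurry_apply_pair]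
        linarith)
    exact h.mono fun z hz ↦ hz.le
  have hmeas : ∀ᶠ u in 𝓝 u₀, AEStronglyMeasurable (f' u) ν := by
    filter_upwards [hUn] with u hu using (hcont u hu).aestronglyMeasurable
  constructor
  · refine hasFDerivAt_integral_of_dominated_of_fderiv_le (bound := fun _ ↦ C + 1) (F' := f')
      (inter_mem hUn hbound) ?_ ?_ hmeas.self_of_nhds ?_ (integrable_const _) ?_
    · filter_upwards [hUn] with u hu using (hf u hu).aestronglyMeasurable
    · exact (hf u₀ hu₀).integrable_of_hasCompactSupport (HasCompactSupport.of_compactSpace _)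
    · exact Eventually.of_forall fun y u hu ↦ hu.2 y (mem_univ y)
    · exact Eventually.of_forall fun y u hu ↦ hd u hu.1 y
  · refine continuousAt_of_dominated (bound := fun _ ↦ C + 1) hmeas ?_ (integrable_const _) ?_
    · filter_upwards [hbound] with u hu using Eventually.of_forall fun y ↦ hu y (mem_univ y)
    · exact Eventually.of_forall fun y ↦
        (hf' u₀ hu₀ y).comp (f := fun u ↦ (u, y)) (by fun_prop)

/-! ### One-variable calculus: weak and diagonal derivatives -/

/-- A compactly supported smooth function on an interval with vanishing integral is the derivative
of a compactly supported smooth function. -/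
theorem exists_contDiff_deriv_eq_of_integral_eq_zero {a b : ℝ} {f : ℝ → ℝ} (hf : ContDiff ℝ ∞ f)
    (hfc : HasCompactSupport f) (hfs : tsupport f ⊆ Ioo a b) (h0 : ∫ t, f t = 0) :
    ∃ g : ℝ → ℝ, ContDiff ℝ ∞ g ∧ HasCompactSupport g ∧ tsupport g ⊆ Ioo a b ∧ deriv g = f := by
  rcases (tsupport f).eq_empty_or_nonempty with he | hne
  · rw [tsupport_eq_empty_iff] at he
    subst he
    exact ⟨0, contDiff_const, by simp [HasCompactSupport], by simp, by
      ext t; exact deriv_const t (0 : ℝ)⟩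
  obtain ⟨c, hc, hcmin⟩ := hfc.isCompact.exists_isMinOn hne continuous_id.continuousOn
  obtain ⟨d, hd, hdmax⟩ := hfc.isCompact.exists_isMaxOn hne continuous_id.continuousOn
  have hz (t : ℝ) (ht : t < c ∨ d < t) : f t = 0 := by
    refine image_eq_zero_of_notMem_tsupport fun hmem ↦ ?_
    have h1 : c ≤ t := hcmin hmem
    have h2 : t ≤ d := hdmax hmem
    rcases ht with ht | ht <;> linarith
  have hint : Integrable f := hf.continuous.integrable_of_hasCompactSupport hfc
  let g : ℝ → ℝ := fun t ↦ ∫ s in c..t, f s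
  have hg (t : ℝ) : HasDerivAt g (f t) t := hf.continuous.integral_hasStrictDerivAt c t |>.hasDerivAt
  have hderiv : deriv g = f := funext fun t ↦ (hg t).deriv
  have hgc : ∀ t, t ∉ Icc c d → g t = 0 := by
    intro t ht
    simp only [mem_Icc, not_and_or, not_le] at ht
    rcases ht with ht | ht
    -- `hz` says nothing at the endpoint `c` itself, so that point is discarded as a null set.
    · refine intervalIntegral.integral_zero_ae ?_
      filter_upwards [compl_mem_ae_iff.2 (measure_singleton c)] with s hs hmem
      rw [uIoc_of_ge ht.le] at hmem
      exact hz s (Or.inl (lt_of_le_of_ne hmem.2 hs))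
    · have hcd : c ≤ d := hcmin hd
      have hsub : Function.support f ⊆ Icc c t := by
        intro s hs
        by_contra hcon
        simp only [mem_Icc, not_and_or, not_le] at hcon
        exact hs (hz s (hcon.imp id fun h ↦ ht.trans h))
      change ∫ s in c..t, f s = 0
      rw [intervalIntegral.integral_of_le (by linarith), ← integral_Icc_eq_integral_Ioc,
        setIntegral_eq_integral_of_forall_compl_eq_zero, h0]
      intro s hs
      by_contra hcon
      exact hs (hsub hcon)
  have hts : tsupport g ⊆ Icc c d :=
    closure_minimal (fun t ht ↦ by_contra fun hcon ↦ ht (hgc t hcon)) isClosed_Icc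
  refine ⟨g, ?_, HasCompactSupport.intro isCompact_Icc hgc, hts.trans ?_, hderiv⟩
  · rw [contDiff_infty_iff_deriv, hderiv]
    exact ⟨fun t ↦ (hg t).differentiableAt, hf⟩
  · exact Icc_subset_Ioo (hfs hc).1 (hfs hd).2

/-- The **du Bois-Reymond lemma**: a continuous function with continuous distributional derivative
is differentiable. -/
theorem hasDerivAt_of_forall_integral_deriv_mul_add {a b : ℝ} {g h : ℝ → ℝ}
    (hg : ContinuousOn g (Ioo a b)) (hh : ContinuousOn h (Ioo a b))
    (H : ∀ η : ℝ → ℝ, ContDiff ℝ ∞ η → HasCompactSupport η → tsupport η ⊆ Ioo a b →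
      ∫ t in Ioo a b, (deriv η t * g t + η t * h t) = 0) {t : ℝ} (ht : t ∈ Ioo a b) :
    HasDerivAt g (h t) t := by
  -- With `P` a primitive of `h`, the claim reduces to `g - P` being constant; `key` says that its
  -- distributional derivative vanishes.
  let P : ℝ → ℝ := fun s ↦ ∫ r in t..s, h r
  have hP (s) (hs : s ∈ Ioo a b) : HasDerivAt P (h s) s := by
    have hsub : uIcc t s ⊆ Ioo a b := ordConnected_Ioo.uIcc_subset ht hs
    exact intervalIntegral.integral_hasDerivAt_right
      ((hh.mono hsub).intervalIntegrable)
      (hh.stronglyMeasurableAtFilter isOpen_Ioo s hs)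
      (hh.continuousAt (isOpen_Ioo.mem_nhds hs))
  have hPc : ContinuousOn P (Ioo a b) := fun s hs ↦ (hP s hs).continuousAt.continuousWithinAt
  -- products of functions continuous on the interval with test functions
  have hmul {η w : ℝ → ℝ} (hη : Continuous η) (hηc : HasCompactSupport η)
      (hηs : tsupport η ⊆ Ioo a b) (hw : ContinuousOn w (Ioo a b)) :
      Integrable (fun s ↦ η s * w s) := by
    have hsup : tsupport (fun s ↦ η s * w s) ⊆ tsupport η := tsupport_mul_subset_left
    refine Continuous.integrable_of_hasCompactSupport ?_ (hηc.mul_right)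
    refine continuous_of_tsupport fun s hs ↦ ?_
    exact hη.continuousAt.mul (hw.continuousAt (isOpen_Ioo.mem_nhds (hηs (hsup hs))))
  have hset {w : ℝ → ℝ} (hw : tsupport w ⊆ Ioo a b) : ∫ s in Ioo a b, w s = ∫ s, w s :=
    setIntegral_eq_integral_of_forall_compl_eq_zero fun s hs ↦
      image_eq_zero_of_notMem_tsupport fun hcon ↦ hs (hw hcon)
  have key {η : ℝ → ℝ} (hη : ContDiff ℝ ∞ η) (hηc : HasCompactSupport η)
      (hηs : tsupport η ⊆ Ioo a b) : ∫ s, deriv η s * (g s - P s) = 0 := by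
    have hη' : Continuous (deriv η) := hη.continuous_deriv (by simp)
    have hdc : HasCompactSupport (deriv η) := hηc.deriv
    have hds : tsupport (deriv η) ⊆ Ioo a b := (closure_minimal (support_deriv_subset)
      (isClosed_tsupport η)).trans hηs
    have i1 := hmul hη' hdc hds hg
    have i2 := hmul hη' hdc hds hPc
    have i3 := hmul hη.continuous hηc hηs hh
    have i4 := hmul hη.continuous hηc hηs hPc
    have e1 := H η hη hηc hηs
    rw [integral_add i1.integrableOn i3.integrableOn, hset (tsupport_mul_subset_left.trans hds),
      hset (tsupport_mul_subset_left.trans hηs)] at e1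
    have e2 : ∫ s, P s * deriv η s = -∫ s, h s * η s :=
      integral_mul_deriv_eq_deriv_mul_of_integrable (fun s hs ↦ hP s (hηs hs))
        (fun s _ ↦ (hη.differentiable (by simp) s).hasDerivAt)
        (by simpa only [mul_comm] using! i2) (by simpa only [mul_comm] using! i3)
        (by simpa only [mul_comm] using! i4)
    simp only [mul_sub]
    rw [integral_sub i1 i2]
    simp only [mul_comm (deriv η _) (P _), e2, mul_comm (h _) (η _)]
    linarith
  -- a normalised bump function inside the interval
  obtain ⟨ρ, hρ, hρc, hρs, hρ1⟩ : ∃ ρ : ℝ → ℝ, ContDiff ℝ ∞ ρ ∧ HasCompactSupport ρ ∧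
      tsupport ρ ⊆ Ioo a b ∧ ∫ s, ρ s = 1 := by
    obtain ⟨ε, hε, hball⟩ := Metric.isOpen_iff.1 isOpen_Ioo t ht
    let φ : ContDiffBump t := ⟨ε / 4, ε / 2, by positivity, by linarith⟩
    refine ⟨φ.normed volume, φ.contDiff_normed, φ.hasCompactSupport_normed, ?_,
      φ.integral_normed⟩
    rw [φ.tsupport_normed_eq]
    exact (Metric.closedBall_subset_ball (by change ε / 2 < ε; linarith)).trans hball
  let c := ∫ s, ρ s * (g s - P s)
  have hgP : ContinuousOn (fun s ↦ g s - P s) (Ioo a b) := hg.sub hPc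
  have hgPc : ContinuousOn (fun s ↦ g s - P s - c) (Ioo a b) := hgP.sub continuousOn_const
  have hae : ∀ᵐ s, s ∈ Ioo a b → g s - P s - c = 0 := by
    refine isOpen_Ioo.ae_eq_zero_of_integral_contDiff_smul_eq_zero
      (hgPc.locallyIntegrableOn measurableSet_Ioo) fun ζ hζ hζc hζs ↦ ?_
    let k := ∫ s, ζ s
    have hiζ : Integrable ζ := hζ.continuous.integrable_of_hasCompactSupport hζc
    have hiρ : Integrable ρ := hρ.continuous.integrable_of_hasCompactSupport hρc
    -- Subtracting `k * ρ` from `ζ` makes its integral zero, so it is some `η'`; `key` then gives `∫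
    -- ζ (g - P) = c ∫ ζ`.
    obtain ⟨η, hη, hηc, hηs, hη'⟩ := exists_contDiff_deriv_eq_of_integral_eq_zero
      (f := fun s ↦ ζ s - k * ρ s) (a := a) (b := b) (hζ.sub (contDiff_const.mul hρ))
      (hζc.sub hρc.mul_left) ((tsupport_sub ζ (fun s ↦ k * ρ s)).trans
        (union_subset hζs (tsupport_mul_subset_right.trans hρs)))
      (by rw [integral_sub hiζ (hiρ.const_mul k), integral_const_mul, hρ1]; simp [k])
    have e := key hη hηc hηs
    rw [hη'] at e
    simp only [sub_mul, mul_assoc] at e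
    rw [integral_sub (hmul hζ.continuous hζc hζs hgP)
      ((hmul hρ.continuous hρc hρs hgP).const_mul k), integral_const_mul] at e
    simp only [smul_eq_mul, mul_sub _ _ c]
    rw [integral_sub (hmul hζ.continuous hζc hζs hgP) (hiζ.mul_const c), integral_mul_const]
    exact e
  have heq : EqOn (fun s ↦ g s - P s - c) (fun _ ↦ 0) (Ioo a b) :=
    Measure.eqOn_open_of_ae_eq ((ae_restrict_iff' measurableSet_Ioo).2 hae) isOpen_Ioo hgPc
      continuousOn_const
  refine ((hP t ht).add_const c).congr_of_eventuallyEq ?_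
  filter_upwards [isOpen_Ioo.mem_nhds ht] with s hs
  have := heq hs
  simp only at this
  linarith

/-- The diagonal derivative of a symmetric function of two real variables with continuous partial
derivative. -/
theorem hasDerivAt_diag_of_symm {Φ h : ℝ → ℝ → ℝ} {U : Set ℝ} (hU : IsOpen U)
    (hsymm : ∀ s t, Φ s t = Φ t s) (hd : ∀ s ∈ U, ∀ t ∈ U, HasDerivAt (Φ s) (h s t) t)
    (hh : ContinuousOn (Function.uncurry h) (U ×ˢ U)) {t : ℝ} (ht : t ∈ U) :
    HasDerivAt (fun s ↦ Φ s s) (2 * h t t) t := by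
  have hn : U ×ˢ U ∈ 𝓝 (t, t) := (hU.prod hU).mem_nhds ⟨ht, ht⟩
  have hc : ContinuousAt (Function.uncurry h) (t, t) := hh.continuousAt hn
  -- By symmetry the partial derivative in the first variable is `h y x`. Continuous partials give
  -- strict differentiability, and on the diagonal the two contributions coincide.
  have h1 := hasStrictFDerivAt_uncurry_coprod (u := (t, t)) (f := Φ)
    (f₁ := fun x y ↦ ContinuousLinearMap.toSpanSingleton ℝ (h y x))
    (f₂ := fun x y ↦ ContinuousLinearMap.toSpanSingleton ℝ (h x y)) ?_ ?_ ?_ ?_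
  · have h2 := h1.hasFDerivAt.comp_hasDerivAt (f := fun s : ℝ ↦ (s, s)) t
      ((hasDerivAt_id t).prodMk (hasDerivAt_id t))
    convert! h2 using 1
    simp [Function.HasUncurry.uncurry]
    ring
  · filter_upwards [hn] with v hv
    have := (hd v.2 hv.2 v.1 hv.1).hasFDerivAt
    rwa [show Φ v.2 = fun x ↦ Φ x v.2 from funext (hsymm v.2)] at this
  · filter_upwards [hn] with v hv using (hd v.1 hv.1 v.2 hv.2).hasFDerivAt
  · have hsw : ContinuousAt (fun p : ℝ × ℝ ↦ Function.uncurry h p.swap) (t, t) :=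
      ContinuousAt.comp (f := Prod.swap) (g := Function.uncurry h) hc continuous_swap.continuousAt
    exact ((ContinuousLinearMap.toSpanSingletonCLE (𝕜 := ℝ) (E := ℝ)).continuous.continuousAt).comp
      hsw
  · exact ((ContinuousLinearMap.toSpanSingletonCLE (𝕜 := ℝ) (E := ℝ)).continuous.continuousAt).comp
      hc

/-! ### Linear equations with continuous coefficients -/

/-- The solution of a linear equation with continuous coefficients is continuous wherever the
equation is uniquely solvable. -/
theorem ContinuousAt.of_clm_apply_eq {X E F : Type*} [TopologicalSpace X] [NormedAddCommGroup E]
    [NormedSpace ℝ E] [CompleteSpace E] [NormedAddCommGroup F] [NormedSpace ℝ F]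
    {A : X → E →L[ℝ] F} {w : X → E} {ℓ : X → F} {p : X} (hA : ContinuousAt A p)
    (hℓ : ContinuousAt ℓ p) (hinv : (A p).IsInvertible) (h : ∀ᶠ q in 𝓝 p, A q (w q) = ℓ q) :
    ContinuousAt w p := by
  obtain ⟨e, he⟩ := hinv
  have hi : ContinuousAt (fun q ↦ (A q).inverse (ℓ q)) p := by
    refine ContinuousAt.clm_apply ?_ hℓ
    refine ContinuousAt.comp (g := ContinuousLinearMap.inverse) ?_ hA
    rw [← he]
    exact (contDiffAt_map_inverse (𝕜 := ℝ) (n := 0) e).continuousAt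
  refine hi.congr ?_
  -- Invertibility is an open condition, so near `p` the solution is `(A q)⁻¹ (ℓ q)`.
  have hn : ∀ᶠ q in 𝓝 p, A q ∈ range ((↑) : (E ≃L[ℝ] F) → E →L[ℝ] F) :=
    hA (he ▸ ContinuousLinearEquiv.nhds e)
  filter_upwards [h, hn] with q hq ⟨e', he'⟩
  rw [← hq, ← he', ContinuousLinearMap.inverse_equiv]
  simp

/-- A positive definite bilinear form on a finite-dimensional space is invertible. -/
theorem ContinuousLinearMap.isInvertible_of_pos {E : Type*} [NormedAddCommGroup E]
    [NormedSpace ℝ E] [FiniteDimensional ℝ E] (B : E →L[ℝ] E →L[ℝ] ℝ)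
    (hB : ∀ v, v ≠ 0 → 0 < B v v) : B.IsInvertible := by
  have hinj : Function.Injective B := by
    rw [injective_iff_map_eq_zero]
    intro v hv
    by_contra hne
    have := hB v hne
    simp [hv] at this
  have hfin : Module.finrank ℝ E = Module.finrank ℝ (E →L[ℝ] ℝ) := by
    rw [← Subspace.dual_finrank_eq (K := ℝ) (V := E)]
    exact LinearEquiv.finrank_eq (LinearMap.toContinuousLinearMap (𝕜 := ℝ) (E := E) (F' := ℝ))
  refine ⟨(LinearEquiv.ofInjectiveOfFinrankEq (B : E →ₗ[ℝ] E →L[ℝ] ℝ) hinj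
    hfin).toContinuousLinearEquiv, ?_⟩
  ext v w
  rfl

namespace SelfAttention

variable {n : ℕ} {M : Type*} [TopologicalSpace M] [ChartedSpace (EuclideanSpace ℝ (Fin n)) M]

/-! ### Continuity of the Riemannian gradient -/

section Gradient

variable [IsManifold (𝓡 n) ∞ M]

theorem isContinuousRiemannianBundle_tangentSpace
    [RiemannianBundle (fun x : M ↦ TangentSpace (𝓡 n) x)]
    [h : IsContMDiffRiemannianBundle (𝓡 n) ∞ (EuclideanSpace ℝ (Fin n))
      (fun x : M ↦ TangentSpace (𝓡 n) x)] :
    IsContinuousRiemannianBundle (EuclideanSpace ℝ (Fin n))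
      (fun x : M ↦ TangentSpace (𝓡 n) x) := by
  obtain ⟨g, hg, hgi⟩ := h.exists_contMDiff
  exact ⟨g, hg.continuous, hgi⟩

/-- The gradient in the first variable of a `C^1` function depends continuously on both
variables. -/
theorem continuous_dualityMap_mvfderiv [RiemannianBundle (fun x : M ↦ TangentSpace (𝓡 n) x)]
    [IsContMDiffRiemannianBundle (𝓡 n) ∞ (EuclideanSpace ℝ (Fin n))
      (fun x : M ↦ TangentSpace (𝓡 n) x)] {F : M → M → ℝ}
    (hF : ContMDiff ((𝓡 n).prod (𝓡 n)) 𝓘(ℝ, ℝ) 1 (Function.uncurry F)) :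
    Continuous fun p : M × M ↦
      (⟨p.1, dualityMap p.1 (mvfderiv (𝓡 n) (fun x ↦ F x p.2) p.1)⟩ : TangentBundle (𝓡 n) M) := by
  let E := EuclideanSpace ℝ (Fin n)
  have : IsContinuousRiemannianBundle E (fun x : M ↦ TangentSpace (𝓡 n) x) :=
    isContinuousRiemannianBundle_tangentSpace
  obtain ⟨g, hg, hgi⟩ := this.exists_continuous
  rw [continuous_iff_continuousAt]
  intro p₀
  refine (FiberBundle.continuousAt_totalSpace _ _).2 ⟨continuous_fst.continuousAt, ?_⟩
  -- In the trivialization at `p₀.1`, `G` is the metric and `L` below the differential; the gradient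
  -- coordinates `w` solve `G w = L`, so their continuity follows from that of `G` and `L`.
  let G : M → E →L[ℝ] E →L[ℝ] ℝ := fun x ↦
    ContinuousLinearMap.inCoordinates E (TangentSpace (𝓡 n)) (E →L[ℝ] ℝ)
      (fun x ↦ TangentSpace (𝓡 n) x →L[ℝ] ℝ) p₀.1 x p₀.1 x (g x)
  let e := trivializationAt E (TangentSpace (𝓡 n) (M := M)) p₀.1
  have hG : ContinuousAt G p₀.1 := ((continuousAt_hom_bundle (σ := RingHom.id ℝ) _).1 hg.continuousAt).2
  have hGe {x : M} (hx : x ∈ e.baseSet) (u v : E) :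
      G x u v = inner ℝ (e.symm x u) (e.symm x v) := by
    rw [hgi]
    simp only [G]
    rw [inCoordinates_apply_eq₂ hx hx (mem_univ _)]
    simp only [Trivial.fiberBundle_trivializationAt', Trivial.linearMapAt_trivialization]
    rfl
  let L : M × M → E →L[ℝ] ℝ := inTangentCoordinates (𝓡 n) 𝓘(ℝ, ℝ) Prod.fst
    (fun p : M × M ↦ F p.1 p.2) (fun p ↦ mfderiv (𝓡 n) 𝓘(ℝ, ℝ) (fun x ↦ F x p.2) p.1) p₀
  have hL : ContinuousAt L p₀ := by
    have : ContMDiffAt ((𝓡 n).prod (𝓡 n)) 𝓘(ℝ, E →L[ℝ] ℝ) 0 L p₀ := by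
      refine ContMDiffAt.mfderiv (n := 1) (fun (p : M × M) x ↦ F x p.2) Prod.fst ?_
        contMDiffAt_fst (by simp)
      exact (hF.comp (contMDiff_snd.prodMk (contMDiff_snd.comp contMDiff_fst))).contMDiffAt
    exact this.continuousAt
  have hLe {p : M × M} (hp : p.1 ∈ e.baseSet) (u : E) :
      L p u = mvfderiv (𝓡 n) (fun x ↦ F x p.2) p.1 (e.symm p.1 u) := by
    simp only [L, inTangentCoordinates, ContinuousLinearMap.inCoordinates,
      TangentBundle.continuousLinearMapAt_model_space]
    change (mfderiv (𝓡 n) 𝓘(ℝ, ℝ) (fun x ↦ F x p.2) p.1) (e.symmL ℝ p.1 u) = _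
    rw [Trivialization.symmL_apply _ hp]
    rfl
  have hbase : p₀.1 ∈ e.baseSet := FiberBundle.mem_baseSet_trivializationAt' p₀.1
  have hinv : (G p₀.1).IsInvertible := by
    refine ContinuousLinearMap.isInvertible_of_pos _ fun v hv ↦ ?_
    rw [hGe hbase]
    refine real_inner_self_pos.2 fun h0 ↦ hv ?_
    have := e.continuousLinearMapAt_symmL (R := ℝ) hbase v
    rw [← this, Trivialization.symmL_apply _ hbase, h0, map_zero]
  let w : M × M → E := fun p ↦
    e.continuousLinearMapAt ℝ p.1 (dualityMap p.1 (mvfderiv (𝓡 n) (fun x ↦ F x p.2) p.1))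
  have hn : ∀ᶠ p : M × M in 𝓝 p₀, p.1 ∈ e.baseSet :=
    continuous_fst.continuousAt (e.open_baseSet.mem_nhds hbase)
  have hw : ∀ᶠ p in 𝓝 p₀, G p.1 (w p) = L p := by
    filter_upwards [hn] with p hp
    ext u
    have hs : e.symm p.1 (w p) = dualityMap p.1 (mvfderiv (𝓡 n) (fun x ↦ F x p.2) p.1) := by
      rw [← Trivialization.symmL_apply (R := ℝ) _ hp]
      exact e.symmL_continuousLinearMapAt hp _
    rw [hGe hp, hLe hp, ← inner_dualityMap, hs]
  have hwc : ContinuousAt w p₀ :=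
    ContinuousAt.of_clm_apply_eq (A := fun p : M × M ↦ G p.1)
      (ContinuousAt.comp hG continuous_fst.continuousAt) hL hinv hw
  have hwe : ∀ᶠ p in 𝓝 p₀, w p = (e (⟨p.1, dualityMap p.1 (mvfderiv (𝓡 n) (fun x ↦ F x p.2) p.1)⟩ :
      TangentBundle (𝓡 n) M)).2 := by
    filter_upwards [hn] with p hp
    exact congrFun (e.coe_linearMapAt_of_mem (R := ℝ) hp) _
  exact hwc.congr hwe

/-- The pairing `⟨∇_x F(x, y), ∇_x F(x, z)⟩` of the gradients in the first variable. -/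
noncomputable def gradientPairing [RiemannianBundle (fun x : M ↦ TangentSpace (𝓡 n) x)] (F : M → M → ℝ)
    (x y z : M) : ℝ :=
  inner ℝ (dualityMap (n := n) x (mvfderiv (𝓡 n) (fun x ↦ F x y) x))
    (dualityMap (n := n) x (mvfderiv (𝓡 n) (fun x ↦ F x z) x))

theorem continuous_gradientPairing [RiemannianBundle (fun x : M ↦ TangentSpace (𝓡 n) x)]
    [IsContMDiffRiemannianBundle (𝓡 n) ∞ (EuclideanSpace ℝ (Fin n))
      (fun x : M ↦ TangentSpace (𝓡 n) x)] {F : M → M → ℝ}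
    (hF : ContMDiff ((𝓡 n).prod (𝓡 n)) 𝓘(ℝ, ℝ) 1 (Function.uncurry F)) :
    Continuous fun p : M × M × M ↦ gradientPairing (n := n) F p.1 p.2.1 p.2.2 := by
  have h := continuous_dualityMap_mvfderiv (n := n) hF
  have := isContinuousRiemannianBundle_tangentSpace (n := n) (M := M)
  exact Continuous.inner_bundle (F := EuclideanSpace ℝ (Fin n))
    (E := fun x : M ↦ TangentSpace (𝓡 n) x) (b := fun p : M × M × M ↦ p.1)
    (h.comp (f := fun p : M × M × M ↦ (p.1, p.2.1)) (by fun_prop))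
    (h.comp (f := fun p : M × M × M ↦ (p.1, p.2.2)) (by fun_prop))

end Gradient

/-! ### Averages of `C^1` kernels -/

section Average

variable [IsManifold (𝓡 n) ∞ M] [CompactSpace M] [MeasurableSpace M] [BorelSpace M]

/-- The local representation of the average of a `C^1` kernel and its derivative. -/
theorem hasFDerivAt_kernelAverage_comp_extChartAt_symm {F : M → M → ℝ}
    (hF : ContMDiff ((𝓡 n).prod (𝓡 n)) 𝓘(ℝ, ℝ) 1 (Function.uncurry F)) (ν : Measure M)
    [IsFiniteMeasure ν] (x₀ : M) {u : EuclideanSpace ℝ (Fin n)}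
    (hu : u ∈ (extChartAt (𝓡 n) x₀).target) :
    HasFDerivAt (kernelAverage F ν ∘ (extChartAt (𝓡 n) x₀).symm)
        (∫ y, fderiv ℝ (fun v ↦ F ((extChartAt (𝓡 n) x₀).symm v) y) u ∂ν) u ∧
      ContinuousAt (fun u ↦ ∫ y, fderiv ℝ (fun v ↦ F ((extChartAt (𝓡 n) x₀).symm v) y) u ∂ν) u ∧
      Integrable (fun y ↦ fderiv ℝ (fun v ↦ F ((extChartAt (𝓡 n) x₀).symm v) y) u) ν := by
  set φ := extChartAt (𝓡 n) x₀
  have hU : IsOpen φ.target := isOpen_extChartAt_target x₀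
  have hφs (v) (hv : v ∈ φ.target) :
      ContMDiffAt 𝓘(ℝ, EuclideanSpace ℝ (Fin n)) (𝓡 n) 1 φ.symm v :=
    (contMDiffOn_extChartAt_symm x₀).contMDiffAt (hU.mem_nhds hv)
  have hjoint (v) (hv : v ∈ φ.target) (y : M) :
      ContinuousAt (Function.uncurry fun v y ↦ fderiv ℝ (fun w ↦ F (φ.symm w) y) v) (v, y) := by
    have h : ContMDiffAt (𝓘(ℝ, EuclideanSpace ℝ (Fin n)).prod (𝓡 n))
        𝓘(ℝ, EuclideanSpace ℝ (Fin n) →L[ℝ] ℝ) 0 _ (v, y) :=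
      ContMDiffAt.mfderiv (n := 1) (I := 𝓘(ℝ, EuclideanSpace ℝ (Fin n))) (I' := 𝓘(ℝ, ℝ))
        (x₀ := (v, y)) (fun (p : EuclideanSpace ℝ (Fin n) × M) w ↦ F (φ.symm w) p.2) Prod.fst
        (hF.contMDiffAt.comp _ (((hφs v hv).comp ((v, y), v) contMDiffAt_snd).prodMk
          (contMDiffAt_snd.comp _ contMDiffAt_fst))) contMDiffAt_fst (by simp)
    have h' := h.continuousAt
    erw [inTangentCoordinates_model_space] at h'
    simpa only [mfderiv_eq_fderiv] using! h'
  have hd (v) (hv : v ∈ φ.target) (y : M) :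
      HasFDerivAt (fun w ↦ F (φ.symm w) y) (fderiv ℝ (fun w ↦ F (φ.symm w) y) v) v := by
    have h : ContMDiffAt 𝓘(ℝ, EuclideanSpace ℝ (Fin n)) 𝓘(ℝ, ℝ) 1 (fun w ↦ F (φ.symm w) y) v :=
      hF.contMDiffAt.comp (f := fun w ↦ (φ.symm w, y)) _ ((hφs v hv).prodMk contMDiffAt_const)
    exact (h.contDiffAt.differentiableAt one_ne_zero).hasFDerivAt
  have hc (v : EuclideanSpace ℝ (Fin n)) : Continuous fun y ↦ F (φ.symm v) y :=
    hF.continuous.comp (f := fun y ↦ (φ.symm v, y)) (by fun_prop)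
  obtain ⟨h1, h2⟩ := hasFDerivAt_integral_of_continuousAt_uncurry (ν := ν) hU
    (f := fun v y ↦ F (φ.symm v) y) (fun v _ ↦ hc v) hd hjoint hu
  refine ⟨h1, h2, ?_⟩
  have hcont : Continuous fun y ↦ fderiv ℝ (fun v ↦ F (φ.symm v) y) u :=
    continuous_iff_continuousAt.2 fun y ↦ (hjoint u hu y).comp (f := fun y ↦ (u, y)) (by fun_prop)
  exact hcont.integrable_of_hasCompactSupport (HasCompactSupport.of_compactSpace _)

/-- Differentiation under the integral in each chart; this makes `W[ν]` an admissible spatial factor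
of a test function. -/
theorem contMDiff_kernelAverage {F : M → M → ℝ}
    (hF : ContMDiff ((𝓡 n).prod (𝓡 n)) 𝓘(ℝ, ℝ) 1 (Function.uncurry F)) (ν : Measure M)
    [IsProbabilityMeasure ν] : ContMDiff (𝓡 n) 𝓘(ℝ, ℝ) 1 (kernelAverage F ν) := by
  intro x₀
  refine contMDiffAt_iff.2 ⟨?_, ?_⟩
  · exact (continuous_integral_probabilityMeasure (F := F) hF.continuous
      (κ := fun _ ↦ ⟨ν, inferInstance⟩) continuous_const).continuousAt
  · refine ContDiffAt.contDiffWithinAt (contDiffAt_one_iff.2 ⟨_, (extChartAt (𝓡 n) x₀).target,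
      (isOpen_extChartAt_target x₀).mem_nhds (mem_extChartAt_target x₀),
      fun u hu ↦ (hasFDerivAt_kernelAverage_comp_extChartAt_symm hF ν x₀
        hu).2.1.continuousWithinAt,
      fun u hu ↦ (hasFDerivAt_kernelAverage_comp_extChartAt_symm hF ν x₀ hu).1⟩)

/-- In the chart centred at `x` both differentials are ordinary Fréchet derivatives, and evaluation
at `v` commutes with the integral. -/
theorem mvfderiv_kernelAverage_apply {F : M → M → ℝ}
    (hF : ContMDiff ((𝓡 n).prod (𝓡 n)) 𝓘(ℝ, ℝ) 1 (Function.uncurry F)) (ν : Measure M)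
    [IsProbabilityMeasure ν] (x : M) (v : TangentSpace (𝓡 n) x) :
    mvfderiv (𝓡 n) (kernelAverage F ν) x v = ∫ y, mvfderiv (𝓡 n) (fun x ↦ F x y) x v ∂ν := by
  obtain ⟨h1, -, h3⟩ := hasFDerivAt_kernelAverage_comp_extChartAt_symm hF ν x
    (mem_extChartAt_target x)
  have hFy (y : M) : ContMDiff (𝓡 n) 𝓘(ℝ, ℝ) 1 fun x ↦ F x y :=
    hF.comp (contMDiff_id.prodMk contMDiff_const)
  have e1 : mvfderiv (𝓡 n) (kernelAverage F ν) x =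
      fderiv ℝ (kernelAverage F ν ∘ (extChartAt (𝓡 n) x).symm) (extChartAt (𝓡 n) x x) := by
    rw [((contMDiff_kernelAverage hF ν).mdifferentiable one_ne_zero x).mvfderiv,
      ModelWithCorners.Boundaryless.range_eq_univ, fderivWithin_univ]
    rfl
  have e2 (y : M) : mvfderiv (𝓡 n) (fun x ↦ F x y) x =
      fderiv ℝ (fun v ↦ F ((extChartAt (𝓡 n) x).symm v) y) (extChartAt (𝓡 n) x x) := by
    rw [((hFy y).mdifferentiable one_ne_zero x).mvfderiv,
      ModelWithCorners.Boundaryless.range_eq_univ, fderivWithin_univ]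
    rfl
  simp only [e1, e2]
  rw [h1.fderiv]
  exact ContinuousLinearMap.integral_apply h3 v

end Average

end SelfAttention

namespace SelfAttention

variable {n : ℕ} {M : Type*} [TopologicalSpace M] [ChartedSpace (EuclideanSpace ℝ (Fin n)) M]

/-! ### Test functions -/

/-- The time derivative of a test function is continuous. -/
theorem IsTestFunction.continuous_deriv [IsManifold (𝓡 n) ∞ M] {T : ℝ} {φ : M × ℝ → ℝ}
    (hφ : IsTestFunction (n := n) T φ) :
    Continuous fun p : M × ℝ ↦ deriv (fun s ↦ φ (p.1, s)) p.2 := by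
  rw [continuous_iff_continuousAt]
  intro p
  have h : ContMDiffAt ((𝓡 n).prod 𝓘(ℝ, ℝ)) 𝓘(ℝ, ℝ →L[ℝ] ℝ) 0 _ p :=
    ContMDiffAt.mfderiv (n := 1) (I := 𝓘(ℝ, ℝ)) (I' := 𝓘(ℝ, ℝ)) (x₀ := p)
      (fun (p : M × ℝ) s ↦ φ (p.1, s)) Prod.snd
      (hφ.1.contMDiffAt.comp _ ((contMDiffAt_fst.comp _ contMDiffAt_fst).prodMk contMDiffAt_snd))
      contMDiffAt_snd (by simp)
  have h' := h.continuousAt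
  erw [inTangentCoordinates_model_space] at h'
  simp only [mfderiv_eq_fderiv] at h'
  exact h'.clm_apply (continuousAt_const (y := (1 : ℝ)))

theorem IsTestFunction.hasCompactSupport_deriv {T : ℝ} {φ : M × ℝ → ℝ}
    (hφ : IsTestFunction (n := n) T φ) :
    HasCompactSupport fun p : M × ℝ ↦ deriv (fun s ↦ φ (p.1, s)) p.2 := by
  refine hφ.2.1.mono' fun p hp ↦ ?_
  by_contra hcon
  refine hp ?_
  have h : φ =ᶠ[𝓝 p] 0 := notMem_tsupport_iff_eventuallyEq.1 hcon
  have hc : Tendsto (fun s ↦ (p.1, s)) (𝓝 p.2) (𝓝 p) := by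
    have : Continuous fun s : ℝ ↦ (p.1, s) := by fun_prop
    exact this.tendsto p.2
  have h2 : (fun s ↦ φ (p.1, s)) =ᶠ[𝓝 p.2] fun _ ↦ 0 := hc.eventually h
  change deriv (fun s ↦ φ (p.1, s)) p.2 = 0
  rw [h2.deriv_eq, deriv_const]

/-- Products of a function of time and a function of space are test functions. -/
theorem isTestFunction_mul [CompactSpace M] {T : ℝ} {η : ℝ → ℝ} (hη : ContDiff ℝ 1 η)
    (hηc : HasCompactSupport η) (hηs : tsupport η ⊆ Ioo 0 T) {ψ : M → ℝ}
    (hψ : ContMDiff (𝓡 n) 𝓘(ℝ, ℝ) 1 ψ) :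
    IsTestFunction (n := n) T fun p : M × ℝ ↦ η p.2 * ψ p.1 := by
  have hsup : tsupport (fun p : M × ℝ ↦ η p.2 * ψ p.1) ⊆ univ ×ˢ tsupport η := by
    refine closure_minimal (fun p hp ↦ ⟨mem_univ _, ?_⟩) (isClosed_univ.prod (isClosed_tsupport η))
    exact subset_tsupport _ (left_ne_zero_of_mul hp)
  exact ⟨(hη.contMDiff.comp contMDiff_snd).mul (hψ.comp contMDiff_fst),
    (isCompact_univ.prod hηc).of_isClosed_subset (isClosed_tsupport _) hsup,
    hsup.trans (prod_mono_right hηs)⟩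

variable [IsManifold (𝓡 n) ∞ M] [CompactSpace M]
  [RiemannianBundle (fun x : M ↦ TangentSpace (𝓡 n) x)]
  [MeasurableSpace M] [BorelSpace M] {K W : M → M → ℝ}

/-! ### Velocity pairing and dissipation -/

theorem kernelAverage_pos (hK : Continuous (Function.uncurry K)) {C : ℝ} (hC : 0 < C)
    (hKC : ∀ x y, C ≤ K x y) (μ : ProbabilityMeasure M) (x : M) :
    0 < kernelAverage K (μ : Measure M) x := by
  have hint : Integrable (K x) (μ : Measure M) :=
    (hK.comp (f := fun y ↦ (x, y)) (by fun_prop)).integrable_of_hasCompactSupport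
      (HasCompactSupport.of_compactSpace _)
  have := integral_mono (integrable_const (μ := (μ : Measure M)) C) hint (hKC x)
  simp only [integral_const, probReal_univ, one_smul] at this
  exact hC.trans_le this

/-- The action of the differential of `W[ν]` on the velocity field of `μ`. -/
theorem mvfderiv_kernelAverage_velocity
    (hW : ContMDiff ((𝓡 n).prod (𝓡 n)) 𝓘(ℝ, ℝ) 1 (Function.uncurry W))
    (ν μ : ProbabilityMeasure M) (x : M) :
    mvfderiv (𝓡 n) (kernelAverage W (ν : Measure M)) x
        (velocity (n := n) K W (μ : Measure M) x) =
      (kernelAverage K (μ : Measure M) x)⁻¹ *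
        ∫ y, ∫ z, gradientPairing (n := n) W x y z ∂(μ : Measure M) ∂(ν : Measure M) := by
  rw [velocity, map_smul, smul_eq_mul, mvfderiv_kernelAverage_apply hW]
  congr 1
  refine integral_congr_ae (Eventually.of_forall fun y ↦ ?_)
  simp only
  rw [← inner_dualityMap, real_inner_comm, inner_dualityMap, mvfderiv_kernelAverage_apply hW]
  refine integral_congr_ae (Eventually.of_forall fun z ↦ ?_)
  simp only
  rw [← inner_dualityMap, real_inner_comm, gradientPairing]

-- This is `∇W[μ] = m_μ V[μ]` paired with `V[μ]`: the dissipation density, which is nonnegative and,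
-- where `m_μ > 0`, vanishes only with the velocity.
omit [IsManifold (𝓡 n) ∞ M] [CompactSpace M] [BorelSpace M] in
theorem mvfderiv_kernelAverage_velocity_self {μ : Measure M} {x : M}
    (hm : kernelAverage K μ x ≠ 0) :
    mvfderiv (𝓡 n) (kernelAverage W μ) x (velocity (n := n) K W μ x) =
      kernelAverage K μ x * ‖velocity (n := n) K W μ x‖ ^ 2 := by
  rw [← real_inner_self_eq_norm_sq, ← inner_dualityMap]
  conv_rhs => rw [velocity, real_inner_smul_left]
  rw [mul_inv_cancel_left₀ hm]
  rfl

/-- The rate of change of `μ ↦ ∫ W[ν] dμ` along a weak solution. -/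
noncomputable def interactionRate (n : ℕ) [ChartedSpace (EuclideanSpace ℝ (Fin n)) M]
    [RiemannianBundle (fun x : M ↦ TangentSpace (𝓡 n) x)] (K W : M → M → ℝ)
    (ν μ : ProbabilityMeasure M) : ℝ :=
  ∫ x, mvfderiv (𝓡 n) (kernelAverage W (ν : Measure M)) x
    (velocity (n := n) K W (μ : Measure M) x) ∂(μ : Measure M)

omit [IsManifold (𝓡 n) ∞ M] in
theorem interactionRate_self_nonneg (hK : Continuous (Function.uncurry K))
    {C : ℝ} (hC : 0 < C) (hKC : ∀ x y, C ≤ K x y) (μ : ProbabilityMeasure M) :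
    0 ≤ interactionRate n K W μ μ := by
  refine integral_nonneg fun x ↦ ?_
  have hm := kernelAverage_pos hK hC hKC μ x
  simp only [Pi.zero_apply]
  rw [mvfderiv_kernelAverage_velocity_self hm.ne']
  positivity

/-! ### Narrow continuity of the rate and differentiation along solutions -/

section Continuity

variable [IsContMDiffRiemannianBundle (𝓡 n) ∞ (EuclideanSpace ℝ (Fin n))
  (fun x : M ↦ TangentSpace (𝓡 n) x)]

/-- After the gradient pairing formula only integrals of continuous kernels remain: one for `m_μ`,
two nested for the pairing. The lower bound on `K` permits the inversion. -/
theorem continuous_mvfderiv_kernelAverage_velocity (hK : Continuous (Function.uncurry K))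
    {C : ℝ} (hC : 0 < C) (hKC : ∀ x y, C ≤ K x y)
    (hW : ContMDiff ((𝓡 n).prod (𝓡 n)) 𝓘(ℝ, ℝ) 1 (Function.uncurry W)) :
    Continuous fun p : (ProbabilityMeasure M × ProbabilityMeasure M) × M ↦
      mvfderiv (𝓡 n) (kernelAverage W (p.1.1 : Measure M)) p.2
        (velocity (n := n) K W (p.1.2 : Measure M) p.2) := by
  simp only [mvfderiv_kernelAverage_velocity hW]
  refine Continuous.mul (Continuous.inv₀ ?_ fun p ↦ (kernelAverage_pos hK hC hKC _ _).ne') ?_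
  · exact continuous_integral_probabilityMeasure
      (F := fun (p : (ProbabilityMeasure M × ProbabilityMeasure M) × M) y ↦ K p.2 y)
      (κ := fun p ↦ p.1.2)
      (hK.comp (f := fun q : ((ProbabilityMeasure M × ProbabilityMeasure M) × M) × M ↦
        (q.1.2, q.2)) (by fun_prop)) (by fun_prop)
  · refine continuous_integral_probabilityMeasure
      (F := fun (p : (ProbabilityMeasure M × ProbabilityMeasure M) × M) y ↦
        ∫ z, gradientPairing (n := n) W p.2 y z ∂(p.1.2 : Measure M))
      (κ := fun p ↦ p.1.1) ?_ (by fun_prop)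
    refine continuous_integral_probabilityMeasure
      (F := fun (q : ((ProbabilityMeasure M × ProbabilityMeasure M) × M) × M) z ↦
        gradientPairing (n := n) W q.1.2 q.2 z)
      (κ := fun q ↦ q.1.1.2) ?_ (by fun_prop)
    exact (continuous_gradientPairing hW).comp
      (f := fun r : (((ProbabilityMeasure M × ProbabilityMeasure M) × M) × M) × M ↦
        (r.1.1.2, r.1.2, r.2)) (by fun_prop)

theorem continuous_interactionRate (hK : Continuous (Function.uncurry K))
    {C : ℝ} (hC : 0 < C) (hKC : ∀ x y, C ≤ K x y)
    (hW : ContMDiff ((𝓡 n).prod (𝓡 n)) 𝓘(ℝ, ℝ) 1 (Function.uncurry W)) :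
    Continuous fun p : ProbabilityMeasure M × ProbabilityMeasure M ↦
      interactionRate n K W p.1 p.2 :=
  continuous_integral_probabilityMeasure (κ := Prod.snd)
    (F := fun (p : ProbabilityMeasure M × ProbabilityMeasure M) x ↦ mvfderiv (𝓡 n) (kernelAverage W (p.1 : Measure M)) x
      (velocity (n := n) K W (p.2 : Measure M) x))
    (continuous_mvfderiv_kernelAverage_velocity hK hC hKC hW) continuous_snd

theorem integrable_mvfderiv_kernelAverage_velocity (hK : Continuous (Function.uncurry K))
    {C : ℝ} (hC : 0 < C) (hKC : ∀ x y, C ≤ K x y)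
    (hW : ContMDiff ((𝓡 n).prod (𝓡 n)) 𝓘(ℝ, ℝ) 1 (Function.uncurry W))
    (ν μ : ProbabilityMeasure M) :
    Integrable (fun x ↦ mvfderiv (𝓡 n) (kernelAverage W (ν : Measure M)) x
      (velocity (n := n) K W (μ : Measure M) x)) (μ : Measure M) :=
  ((continuous_mvfderiv_kernelAverage_velocity hK hC hKC hW).comp
    (f := fun x ↦ ((ν, μ), x)) (by fun_prop)).integrable_of_hasCompactSupport
      (HasCompactSupport.of_compactSpace _)

/-- A measure with vanishing dissipation has vanishing velocity. -/
theorem velocity_ae_eq_zero_of_interactionRate_self_eq_zero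
    (hK : Continuous (Function.uncurry K)) {C : ℝ} (hC : 0 < C) (hKC : ∀ x y, C ≤ K x y)
    (hW : ContMDiff ((𝓡 n).prod (𝓡 n)) 𝓘(ℝ, ℝ) 1 (Function.uncurry W))
    {μ : ProbabilityMeasure M} (h : interactionRate n K W μ μ = 0) :
    ∀ᵐ x ∂(μ : Measure M), velocity (n := n) K W (μ : Measure M) x = 0 := by
  rw [interactionRate, integral_eq_zero_iff_of_nonneg (fun x ↦ ?_)
    (integrable_mvfderiv_kernelAverage_velocity hK hC hKC hW μ μ)] at h
  · filter_upwards [h] with x hx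
    have hm := kernelAverage_pos hK hC hKC μ x
    rw [mvfderiv_kernelAverage_velocity_self hm.ne'] at hx
    simpa [hm.ne'] using hx
  · have hm := kernelAverage_pos hK hC hKC μ x
    simp only [Pi.zero_apply]
    rw [mvfderiv_kernelAverage_velocity_self hm.ne']
    positivity

/-- The potential of a fixed measure is differentiable along a weak solution. -/
theorem IsWeakSolution.hasDerivAt_integral_kernelAverage (hK : Continuous (Function.uncurry K))
    {C : ℝ} (hC : 0 < C) (hKC : ∀ x y, C ≤ K x y)
    (hW : ContMDiff ((𝓡 n).prod (𝓡 n)) 𝓘(ℝ, ℝ) 1 (Function.uncurry W))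
    {μ : ℝ → ProbabilityMeasure M} (hμ : IsWeakSolution (n := n) K W μ)
    (ν : ProbabilityMeasure M) {t : ℝ} (ht : 0 < t) :
    HasDerivAt (fun s ↦ ∫ x, kernelAverage W (ν : Measure M) x ∂(μ s : Measure M))
      (interactionRate n K W ν (μ t)) t := by
  obtain ⟨hcont, -, heq⟩ := hμ (t + 1) (by linarith)
  have hψ := contMDiff_kernelAverage (n := n) hW (ν : Measure M)
  set ψ := kernelAverage W (ν : Measure M)
  have hrate : Continuous fun m ↦ interactionRate n K W ν m :=
    (continuous_interactionRate hK hC hKC hW).comp (f := fun m ↦ (ν, m)) (by fun_prop)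
  have hpot : Continuous fun m : ProbabilityMeasure M ↦ ∫ x, ψ x ∂(m : Measure M) :=
    ProbabilityMeasure.continuous_integral_continuousMap (⟨ψ, hψ.continuous⟩ : C(M, ℝ))
  -- Tested with products `η(s) ψ(x)`, the weak equation says that the rate is the distributional
  -- derivative of the potential. Both are continuous in time, so the derivative is classical.
  refine hasDerivAt_of_forall_integral_deriv_mul_add
    (h := fun s ↦ interactionRate n K W ν (μ s)) (hpot.comp_continuousOn hcont)
    (hrate.comp_continuousOn hcont) (fun η hη hηc hηs ↦ ?_) ⟨ht, by linarith⟩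
  refine Eq.trans ?_ (heq _ (isTestFunction_mul (n := n) (hη.of_le (by simp)) hηc hηs hψ))
  refine integral_congr_ae (Eventually.of_forall fun s ↦ ?_)
  have h1 (x : M) : deriv (fun r ↦ η r * ψ x) s = deriv η s * ψ x :=
    deriv_mul_const (hη.differentiable (by simp) s) _
  have h2 (x : M) (v : TangentSpace (𝓡 n) x) :
      mvfderiv (𝓡 n) (fun y ↦ η s * ψ y) x v = η s * mvfderiv (𝓡 n) ψ x v := by
    have hc : MDifferentiableAt (𝓡 n) 𝓘(ℝ, ℝ) (fun _ : M ↦ η s) x := mdifferentiableAt_const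
    rw [mvfderiv_fun_mul hc (hψ.mdifferentiable one_ne_zero x), mvfderiv_const]
    simp
  simp only [h1, h2]
  rw [integral_add ((hψ.continuous.integrable_of_hasCompactSupport
      (HasCompactSupport.of_compactSpace _)).const_mul _)
    ((integrable_mvfderiv_kernelAverage_velocity hK hC hKC hW ν (μ s)).const_mul _),
    integral_const_mul, integral_const_mul]
  rfl

end Continuity

/-! ### Stationarity and symmetry of the energy -/

section Stationary

variable [SecondCountableTopology M]

omit [CompactSpace M] in
/-- A measure with vanishing velocity is a stationary solution. -/
theorem isStationarySolution_of_velocity_ae_eq_zero {ν : ProbabilityMeasure M}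
    (h : ∀ᵐ x ∂(ν : Measure M), velocity (n := n) K W (ν : Measure M) x = 0) :
    IsStationarySolution (n := n) K W ν := by
  intro T hT
  refine ⟨continuousOn_const, ?_, fun φ hφ ↦ ?_⟩
  · have h0 : ∫⁻ x, ‖velocity (n := n) K W (ν : Measure M) x‖ₑ ∂(ν : Measure M) = 0 := by
      rw [lintegral_congr_ae (g := fun _ ↦ 0) (by filter_upwards [h] with x hx; simp [hx])]
      simp
    simp [h0]
  · have h1 (t : ℝ) : ∫ x, (deriv (fun s ↦ φ (x, s)) t + mvfderiv (𝓡 n) (fun y ↦ φ (y, t)) x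
        (velocity (n := n) K W (ν : Measure M) x)) ∂(ν : Measure M) =
        ∫ x, deriv (fun s ↦ φ (x, s)) t ∂(ν : Measure M) := by
      refine integral_congr_ae ?_
      filter_upwards [h] with x hx
      rw [hx, map_zero, add_zero]
    simp only [h1]
    have hint : Integrable (fun p : M × ℝ ↦ deriv (fun s ↦ φ (p.1, s)) p.2)
        ((ν : Measure M).prod (volume.restrict (Ioo 0 T))) :=
      hφ.continuous_deriv.integrable_of_hasCompactSupport hφ.hasCompactSupport_deriv
    -- After Fubini, the time integral for each fixed `x` is that of the derivative of a compactly
    -- supported function, hence zero.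
    rw [integral_integral_swap (f := fun t x ↦ deriv (fun s ↦ φ (x, s)) t) hint.swap]
    refine integral_eq_zero_of_ae (Eventually.of_forall fun x ↦ ?_)
    have hx : ContDiff ℝ 1 fun s ↦ φ (x, s) :=
      (hφ.1.comp (contMDiff_const.prodMk contMDiff_id)).contDiff
    have hsub : tsupport (fun s ↦ φ (x, s)) ⊆ Ioo 0 T := fun s hs ↦ by
      have : (x, s) ∈ tsupport φ :=
        closure_minimal (t := (fun s ↦ (x, s)) ⁻¹' tsupport φ)
          (fun r hr ↦ subset_tsupport φ hr)
          ((isClosed_tsupport φ).preimage (by fun_prop)) hs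
      exact (hφ.2.2 this).2
    have hxc : HasCompactSupport fun s ↦ φ (x, s) :=
      HasCompactSupport.of_support_subset_isCompact (K := Icc 0 T) isCompact_Icc
        ((subset_tsupport _).trans (hsub.trans Ioo_subset_Icc_self))
    have hcont : Continuous (deriv fun s ↦ φ (x, s)) := hx.continuous_deriv le_rfl
    simp only [Pi.zero_apply]
    rw [setIntegral_eq_integral_of_forall_compl_eq_zero fun s hs ↦
      image_eq_zero_of_notMem_tsupport fun hcon ↦ hs (hsub (closure_minimal
        support_deriv_subset (isClosed_tsupport _) hcon))]
    exact integral_eq_zero_of_hasDerivAt_of_integrable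
      (fun s ↦ (hx.differentiable one_ne_zero s).hasDerivAt)
      (hcont.integrable_of_hasCompactSupport hxc.deriv)
      (hx.continuous.integrable_of_hasCompactSupport hxc)

/-- Fubini and the symmetry of `W`; this supplies the symmetry that the diagonal chain rule
requires. -/
theorem integral_kernelAverage_comm (hW : Continuous (Function.uncurry W))
    (hWsymm : ∀ x y, W x y = W y x) (ν μ : ProbabilityMeasure M) :
    ∫ x, kernelAverage W (ν : Measure M) x ∂(μ : Measure M) =
      ∫ x, kernelAverage W (μ : Measure M) x ∂(ν : Measure M) := by
  unfold kernelAverage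
  rw [integral_integral_swap (hW.integrable_of_hasCompactSupport
    (HasCompactSupport.of_compactSpace _))]
  simp only [hWsymm]

end Stationary

/-! ### Vanishing dissipation and the limit measure -/

/-- Along a weak solution, the dissipation of the interaction energy vanishes along a sequence of
times tending to infinity. -/
theorem IsWeakSolution.exists_tendsto_interactionRate [T2Space M] [SecondCountableTopology M]
    [IsContMDiffRiemannianBundle (𝓡 n) ∞ (EuclideanSpace ℝ (Fin n))
      (fun x : M ↦ TangentSpace (𝓡 n) x)] (hK : Continuous (Function.uncurry K))
    {C : ℝ} (hC : 0 < C) (hKC : ∀ x y, C ≤ K x y)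
    (hW : ContMDiff ((𝓡 n).prod (𝓡 n)) 𝓘(ℝ, ℝ) 1 (Function.uncurry W))
    (hWsymm : ∀ x y, W x y = W y x)
    {μ : ℝ → ProbabilityMeasure M} (hμ : IsWeakSolution (n := n) K W μ) :
    ∃ t : ℕ → ℝ, Tendsto t atTop atTop ∧
      Tendsto (fun k ↦ interactionRate n K W (μ (t k)) (μ (t k))) atTop (𝓝 0) := by
  have hcont : ContinuousOn μ (Ioi 0) := fun t ht ↦
    ((hμ (t + 1) (by linarith [mem_Ioi.1 ht])).1.continuousAt
      (Ioo_mem_nhds ht (by linarith))).continuousWithinAt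
  let Φ : ProbabilityMeasure M × ProbabilityMeasure M → ℝ := fun p ↦
    ∫ x, kernelAverage W (p.1 : Measure M) x ∂(p.2 : Measure M)
  let e : ℝ → ℝ := fun t ↦ Φ (μ t, μ t)
  have he (t : ℝ) (ht : 0 < t) : HasDerivAt e (2 * interactionRate n K W (μ t) (μ t)) t := by
    refine hasDerivAt_diag_of_symm (Φ := fun s t ↦ Φ (μ s, μ t))
      (h := fun s t ↦ interactionRate n K W (μ s) (μ t)) isOpen_Ioi
      (fun s t ↦ integral_kernelAverage_comm hW.continuous hWsymm _ _)
      (fun s _ t ht ↦ hμ.hasDerivAt_integral_kernelAverage hK hC hKC hW (μ s) ht) ?_ ht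
    exact (continuous_interactionRate hK hC hKC hW).comp_continuousOn (hcont.prodMap hcont)
  have hΦ : Continuous Φ := by
    refine continuous_integral_probabilityMeasure (κ := Prod.snd)
      (F := fun (p : ProbabilityMeasure M × ProbabilityMeasure M) x ↦ kernelAverage W (p.1 : Measure M) x) ?_ continuous_snd
    exact continuous_integral_probabilityMeasure
      (X := (ProbabilityMeasure M × ProbabilityMeasure M) × M) (κ := fun q ↦ q.1.1)
      (F := fun q y ↦ W q.2 y) (hW.continuous.comp
        (f := fun r : ((ProbabilityMeasure M × ProbabilityMeasure M) × M) × M ↦ (r.1.2, r.2))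
        (by fun_prop)) (by fun_prop)
  -- Unit length makes the mean slope equal to the energy increment; starting at `k + 1` keeps the
  -- closed interval inside `t > 0`.
  have hmvt (k : ℕ) : ∃ c ∈ Ioo ((k : ℝ) + 1) (k + 2),
      2 * interactionRate n K W (μ c) (μ c) = e (k + 2) - e (k + 1) := by
    have hpos (s : ℝ) (hs : (k : ℝ) + 1 ≤ s) : 0 < s := lt_of_lt_of_le (by positivity) hs
    obtain ⟨c, hc, hce⟩ := exists_hasDerivAt_eq_slope e
      (fun s ↦ 2 * interactionRate n K W (μ s) (μ s)) (show (k : ℝ) + 1 < k + 2 by linarith)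
      (fun s hs ↦ (he s (hpos s hs.1)).continuousAt.continuousWithinAt)
      (fun s hs ↦ he s (hpos s hs.1.le))
    refine ⟨c, hc, hce.trans ?_⟩
    rw [show (k : ℝ) + 2 - (k + 1) = 1 by ring, div_one]
  choose t ht hte using hmvt
  refine ⟨t, tendsto_atTop_mono (fun k ↦ (by linarith [(ht k).1] : (k : ℝ) ≤ t k))
    tendsto_natCast_atTop_atTop, ?_⟩
  let a : ℕ → ℝ := fun k ↦ e (k + 1)
  have ha (k : ℕ) : a (k + 1) - a k = 2 * interactionRate n K W (μ (t k)) (μ (t k)) := by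
    rw [hte]
    simp only [a]
    push_cast
    ring_nf
  have hmono : Monotone a := monotone_nat_of_le_succ fun k ↦ by
    linarith [ha k, interactionRate_self_nonneg (n := n) (W := W) hK hC hKC (μ (t k))]
  -- The energy is a continuous function on the compact space of probability measures.
  have hbdd : BddAbove (range a) :=
    ((isCompact_range hΦ).bddAbove).mono (by rintro _ ⟨k, rfl⟩; exact mem_range_self _)
  have hlim := tendsto_atTop_ciSup hmono hbdd
  have hdiff := ((hlim.comp (tendsto_add_atTop_nat 1)).sub hlim).div_const 2
  rw [sub_self, zero_div] at hdiff
  refine hdiff.congr fun k ↦ ?_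
  simp only [Function.comp_apply, ha]
  ring

end SelfAttention

theorem mainTheorem5 {n : ℕ} {M : Type*} [TopologicalSpace M] [T2Space M] [CompactSpace M]
    [ChartedSpace (EuclideanSpace ℝ (Fin n)) M] [IsManifold (𝓡 n) ∞ M]
    [RiemannianBundle (fun x : M ↦ TangentSpace (𝓡 n) x)]
    [IsContMDiffRiemannianBundle (𝓡 n) ∞ (EuclideanSpace ℝ (Fin n))
      (fun x : M ↦ TangentSpace (𝓡 n) x)]
    [MeasurableSpace M] [BorelSpace M]
    (K : M → M → ℝ) (hK : Continuous (Function.uncurry K))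
    (hKpos : ∃ C : ℝ, 0 < C ∧ ∀ x y, C ≤ K x y)
    (W : M → M → ℝ) (hWsymm : ∀ x y, W x y = W y x)
    (α : ℝ≥0) (hα : 0 < α) (hW : SelfAttention.IsC1Holder (n := n) α W)
    (μ : ℝ → ProbabilityMeasure M) (hμ : SelfAttention.IsWeakSolution (n := n) K W μ) :
    ∃ (t : ℕ → ℝ) (ν : ProbabilityMeasure M),
      Tendsto t atTop atTop ∧
      Tendsto (fun k ↦ μ (t k)) atTop (𝓝 ν) ∧
      SelfAttention.IsStationarySolution (n := n) K W ν := by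
  obtain ⟨C, hC, hKC⟩ := hKpos
  have hW1 := hW.1
  -- Needed for the Fubini arguments on `M × M` and `M × ℝ`.
  have : SecondCountableTopology M :=
    ChartedSpace.secondCountable_of_sigmaCompact (EuclideanSpace ℝ (Fin n)) M
  obtain ⟨t, ht, hrate⟩ := hμ.exists_tendsto_interactionRate hK hC hKC hW1 hWsymm
  obtain ⟨ν, -, σ, hσ, hν⟩ := isCompact_univ.tendsto_subseq (x := fun k ↦ μ (t k))
    fun _ ↦ mem_univ _
  refine ⟨t ∘ σ, ν, ht.comp hσ.tendsto_atTop, hν, ?_⟩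
  refine SelfAttention.isStationarySolution_of_velocity_ae_eq_zero
    (SelfAttention.velocity_ae_eq_zero_of_interactionRate_self_eq_zero hK hC hKC hW1 ?_)
  -- Along the subsequence the dissipation tends both to zero and, by joint continuity of the rate,
  -- to that of `ν`.
  refine tendsto_nhds_unique ?_ (hrate.comp hσ.tendsto_atTop)
  exact ((SelfAttention.continuous_interactionRate (n := n) hK hC hKC hW1).tendsto (ν, ν)).comp
    (hν.prodMk_nhds hν)
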